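/- For $f:\mathbb{R}^n\to\mathbb{R}$ and $q\in\mathbb{R}$ let $T_q(f)(x)=\max\{q,f(x)\}$. Call $f$ truncated convex (resp. truncated quasiconvex) if there is a real $q\ge\inf f$ such that $T_r(f)$ is convex (resp. quasiconvex) for every real $r\ge q$; the infimum in $[-\infty,+\infty)$ of all such levels $q$ is denoted by $\mathrm{scl}(f)$ (resp. $\mathrm{sql}(f)$). For $f$ of class $C^2$ let $\mathrm{Hess}^+(f)$ be the set of points at which the Hessian matrix of $f$ is positive definite, let $C(f)$ be the set of critical points of $f$, and, when the maximum exists, let $h_{\max}(f)=\max\{f(x) : x\in\mathbb{R}^n\setminus\mathrm{Hess}^+(f)\}$. Let $n\in\{2,3\}$ and let $f:\mathbb{R}^n\to\mathbb{R}$ be a $C^2$ function that is norm-coercive, i.e. $f(x)\to+\infty$ as $\|x\|\to+\infty$. Assume that $\mathbb{R}^n\setminus\mathrm{Hess}^+(f)$ and $C(f)$ are bounded. Then $f$ is truncated convex, and hence truncated quasiconvex. If moreover $\mathbb{R}^n\setminus\mathrm{Hess}^+(f)\neq\emptyset$, then the maximum $h_{\max}(f)$ exists and $$\mathrm{scl}(f)\le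 h_{\max}(f);$$ in particular, the sublevel set $\{x : f(x)\le q\}$ is convex for every real $q>h_{\max}(f)$, and $\mathrm{sql}(f)\le h_{\max}(f)$. -/

import Mathlib

namespace TruncConvex

noncomputable section

/-- The truncation `T_q(f)(x) = max {q, f(x)}`. -/
def truncation {n : ℕ} (q : ℝ) (f : EuclideanSpace ℝ (Fin n) → ℝ) :
    EuclideanSpace ℝ (Fin n) → ℝ :=
  fun x => max q (f x)

/-- The real levels `q ≥ inf f` (the infimum taken in the extended reals) such that `T_r(f)` is
convex for every real `r ≥ q`. -/
def convexityLevels {n : ℕ} (f : EuclideanSpace ℝ (Fin n) → ℝ) : Set ℝ :=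
  {q | (⨅ x, (f x : EReal)) ≤ (q : EReal) ∧
    ∀ r : ℝ, q ≤ r → ConvexOn ℝ Set.univ (truncation r f)}

/-- The real levels `q ≥ inf f` such that `T_r(f)` is quasiconvex for every real `r ≥ q`. -/
def quasiconvexityLevels {n : ℕ} (f : EuclideanSpace ℝ (Fin n) → ℝ) : Set ℝ :=
  {q | (⨅ x, (f x : EReal)) ≤ (q : EReal) ∧
    ∀ r : ℝ, q ≤ r → QuasiconvexOn ℝ Set.univ (truncation r f)}

/-- `f` is truncated convex. -/
def TruncatedConvex {n : ℕ} (f : EuclideanSpace ℝ (Fin n) → ℝ) : Prop :=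
  (convexityLevels f).Nonempty

/-- `f` is truncated quasiconvex. -/
def TruncatedQuasiconvex {n : ℕ} (f : EuclideanSpace ℝ (Fin n) → ℝ) : Prop :=
  (quasiconvexityLevels f).Nonempty

/-- The smallest convexity level, an extended real (it is `-∞` for a nonconstant linear form). -/
def scl {n : ℕ} (f : EuclideanSpace ℝ (Fin n) → ℝ) : EReal :=
  sInf ((fun q : ℝ => (q : EReal)) '' convexityLevels f)

/-- The smallest quasiconvexity level, an extended real. -/
def sql {n : ℕ} (f : EuclideanSpace ℝ (Fin n) → ℝ) : EReal :=
  sInf ((fun q : ℝ => (q : EReal)) '' quasiconvexityLevels f)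

/-- The Hessian matrix of second partial derivatives `∂ᵢ ∂ⱼ f (x)`. -/
def hessian {n : ℕ} (f : EuclideanSpace ℝ (Fin n) → ℝ) (x : EuclideanSpace ℝ (Fin n)) :
    Matrix (Fin n) (Fin n) ℝ :=
  Matrix.of fun i j =>
    fderiv ℝ (fun y => fderiv ℝ f y (EuclideanSpace.single j 1)) x (EuclideanSpace.single i 1)

/-- The region `Hess⁺(f)` where the Hessian matrix is positive definite. -/
def hessPos {n : ℕ} (f : EuclideanSpace ℝ (Fin n) → ℝ) : Set (EuclideanSpace ℝ (Fin n)) :=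
  {x | (hessian f x).PosDef}

/-- The critical set `C(f)`. -/
def criticalSet {n : ℕ} (f : EuclideanSpace ℝ (Fin n) → ℝ) : Set (EuclideanSpace ℝ (Fin n)) :=
  {x | fderiv ℝ f x = 0}

/-- The value `h_max(f)`: the maximum of `f` on the complement of `Hess⁺(f)`, whenever that
maximum exists. -/
def hMax {n : ℕ} (f : EuclideanSpace ℝ (Fin n) → ℝ) : ℝ :=
  sSup (f '' (hessPos f)ᶜ)

end

end TruncConvex

/-!
The truncation `T_q f` is locally convex as soon as the Hessian is positive definite at every
point of `{q ≤ f}`: near a point with `f < q` it is constant, and near any other point it is the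
maximum of a constant and a locally convex function. Local convexity on the whole space implies
convexity, so every such `q ≥ inf f` is a convexity level. This covers each `q > h_max(f)`, whence
`scl(f) ≤ h_max(f)`, and the sublevel set `{f ≤ q} = {T_q f ≤ q}` is convex. When the complement of
`Hess⁺(f)` is empty, every value of `f` is a convexity level.

The passage from local to global is made on lines by a maximum principle
(`max_le_chord_of_deriv_deriv_pos`). Suppose `max q φ` exceeds its chord somewhere, and take the
leftmost point `s` where the excess is largest. If `q ≤ φ s`, then `φ` minus the chord has a local
maximum at `s` and a positive second derivative there. If `φ s < q`, then the excess is affine near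
`s`, with a local maximum at `s` and smaller values on its left. Both are impossible.

The maximum `h_max(f)` exists because the complement of `Hess⁺(f)` is bounded, and closed by
compactness of the unit sphere (`isOpen_hessPos`).
-/

open Set Filter Topology

namespace TruncConvex

/-! ### Functions of one variable -/

theorem not_deriv_deriv_pos_of_isLocalMax {g : ℝ → ℝ} {s : ℝ} (hmax : IsLocalMax g s)
    (hc : ContinuousAt g s) : ¬ 0 < deriv (deriv g) s := by
  intro hpos
  have hmin : IsLocalMin g s := isLocalMin_of_deriv_deriv_pos hpos hmax.deriv_eq_zero hc
  have hconst : g =ᶠ[𝓝 s] fun _ => g s := by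
    filter_upwards [hmax, hmin] with t h₁ h₂ using le_antisymm h₁ h₂
  have h0 : deriv (deriv g) s = 0 := by
    rw [hconst.deriv.deriv_eq]
    simp
  exact hpos.ne' h0

/-- If `φ'' > 0` wherever `q ≤ φ`, then `max q φ` lies below its chord on `[0, 1]`. -/
theorem max_le_chord_of_deriv_deriv_pos {φ : ℝ → ℝ} (hφ : Differentiable ℝ φ) (q : ℝ)
    (hpos : ∀ t, q ≤ φ t → 0 < deriv (deriv φ) t) {t : ℝ} (ht : t ∈ Icc (0 : ℝ) 1) :
    max q (φ t) ≤ (1 - t) * max q (φ 0) + t * max q (φ 1) := by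
  set A := max q (φ 0)
  set B := max q (φ 1)
  by_contra! hlt
  let ψ : ℝ → ℝ := fun u => max q (φ u) - ((1 - u) * A + u * B)
  have hψ : Continuous ψ := by
    have := hφ.continuous
    fun_prop
  obtain ⟨m, hm, hmax⟩ := isCompact_Icc.exists_isMaxOn ⟨t, ht⟩ hψ.continuousOn
  have hS : IsCompact (Icc (0 : ℝ) 1 ∩ {u | ψ u = ψ m}) :=
    isCompact_Icc.inter_right (isClosed_eq hψ continuous_const)
  obtain ⟨s, ⟨hs, hsm⟩, hleast⟩ := hS.exists_isLeast ⟨m, hm, rfl⟩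
  have hsm : ψ s = ψ m := hsm
  have hMpos : 0 < ψ s := by
    have h : ψ t ≤ ψ m := hmax ht
    have : 0 < ψ t := sub_pos.2 hlt
    linarith
  have hs0 : s ≠ 0 := by
    rintro rfl
    simp [ψ, A] at hMpos
  have hs1 : s ≠ 1 := by
    rintro rfl
    simp [ψ, B] at hMpos
  have hs' : s ∈ Ioo (0 : ℝ) 1 := ⟨hs.1.lt_of_ne' hs0, hs.2.lt_of_ne hs1⟩
  have hle : ∀ᶠ u in 𝓝 s, ψ u ≤ ψ s := by
    filter_upwards [Icc_mem_nhds hs'.1 hs'.2] with u hu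
    rw [hsm]
    exact hmax hu
  rcases lt_or_ge (φ s) q with hq | hq
  · -- Near `s` the function `ψ` is affine, so it would have to be constant there, although its
    -- values to the left of `s` are smaller than `ψ s`.
    have hq' : ∀ᶠ u in 𝓝 s, φ u < q := hφ.continuous.continuousAt.eventually_lt_const hq
    obtain ⟨ε, hε, hball⟩ :=
      Metric.eventually_nhds_iff.1 (hle.and (hq'.and (Ioo_mem_nhds hs'.1 hs'.2)))
    have hd₁ : dist (s - ε / 2) s < ε := by
      rw [Real.dist_eq, abs_lt]
      constructor <;> linarith
    have hd₂ : dist (s + ε / 2) s < ε := by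
      rw [Real.dist_eq, abs_lt]
      constructor <;> linarith
    obtain ⟨h₁, hq₁, hI⟩ := hball hd₁
    obtain ⟨h₂, hq₂, -⟩ := hball hd₂
    have hne : ψ (s - ε / 2) ≠ ψ s := fun he => by
      have := hleast ⟨Ioo_subset_Icc_self hI, he.trans hsm⟩
      linarith
    have hlt' := h₁.lt_of_ne hne
    simp only [ψ, max_eq_left hq.le, max_eq_left hq₁.le, max_eq_left hq₂.le] at hlt' h₂
    linarith
  · let g : ℝ → ℝ := fun u => φ u - ((1 - u) * A + u * B)
    have hg : IsLocalMax g s := by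
      filter_upwards [hle] with u hu
      have h₁ : φ u ≤ max q (φ u) := le_max_right _ _
      simp only [ψ, max_eq_right hq] at hu
      simp only [g]
      linarith
    have hderiv : deriv g = fun u => deriv φ u - (B - A) := by
      funext u
      have h₁ : HasDerivAt (fun u : ℝ => (1 - u) * A + u * B) (B - A) u := by
        refine ((((hasDerivAt_id u).const_sub 1).mul_const A).add
          ((hasDerivAt_id u).mul_const B)).congr_deriv ?_
        ring
      exact ((hφ u).hasDerivAt.sub h₁).deriv
    refine not_deriv_deriv_pos_of_isLocalMax hg ?_ ?_
    · have := hφ.continuous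
      fun_prop
    · rw [hderiv, deriv_sub_const]
      exact hpos s hq

/-! ### The Hessian matrix as a bilinear form -/

variable {n : ℕ} {f : EuclideanSpace ℝ (Fin n) → ℝ}

theorem differentiable_fderiv (hf : ContDiff ℝ 2 f) : Differentiable ℝ (fderiv ℝ f) :=
  (hf.fderiv_right (m := 1) (by norm_num)).differentiable (by norm_num)

theorem hessian_apply (hf : ContDiff ℝ 2 f) (x : EuclideanSpace ℝ (Fin n)) (i j : Fin n) :
    hessian f x i j = fderiv ℝ (fderiv ℝ f) x (EuclideanSpace.single i 1)
      (EuclideanSpace.single j 1) := by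
  have h := ((differentiable_fderiv hf x).hasFDerivAt.clm_apply
    (hasFDerivAt_const (EuclideanSpace.single j (1 : ℝ)) x)).fderiv
  simp [hessian, h]

theorem dotProduct_hessian_mulVec (hf : ContDiff ℝ 2 f) (x v : EuclideanSpace ℝ (Fin n)) :
    star v.ofLp ⬝ᵥ (hessian f x).mulVec v.ofLp = fderiv ℝ (fderiv ℝ f) x v v := by
  have hv : v = ∑ i, v i • EuclideanSpace.single i (1 : ℝ) := by
    simpa using ((EuclideanSpace.basisFun (Fin n) ℝ).sum_repr v).symm
  conv_rhs => rw [hv]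
  simp only [map_sum, map_smul, _root_.sum_apply, _root_.smul_apply,
    dotProduct, Matrix.mulVec, hessian_apply hf, Finset.mul_sum, smul_eq_mul, star_trivial]
  rw [Finset.sum_comm]
  refine Finset.sum_congr rfl fun j _ => Finset.sum_congr rfl fun i _ => ?_
  ring

theorem isHermitian_hessian (hf : ContDiff ℝ 2 f) (x : EuclideanSpace ℝ (Fin n)) :
    (hessian f x).IsHermitian := by
  ext i j
  rw [Matrix.conjTranspose_apply, star_trivial, hessian_apply hf, hessian_apply hf]
  exact (hf.contDiffAt.isSymmSndFDerivAt (by simp)) _ _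

theorem mem_hessPos_iff (hf : ContDiff ℝ 2 f) {x : EuclideanSpace ℝ (Fin n)} :
    x ∈ hessPos f ↔ ∀ v, v ≠ 0 → 0 < fderiv ℝ (fderiv ℝ f) x v v := by
  constructor
  · intro hx v hv
    rw [← dotProduct_hessian_mulVec hf]
    exact Matrix.PosDef.dotProduct_mulVec_pos hx fun h => hv (by ext i; simpa using congrFun h i)
  · intro h
    refine Matrix.PosDef.of_dotProduct_mulVec_pos (isHermitian_hessian hf x) fun w hw => ?_
    have := h (WithLp.toLp 2 w) fun h0 => hw (by simpa using h0)
    rwa [← dotProduct_hessian_mulVec hf] at this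

theorem isOpen_hessPos (hf : ContDiff ℝ 2 f) : IsOpen (hessPos f) := by
  rw [isOpen_iff_eventually]
  intro x hx
  have hcont : Continuous (fderiv ℝ (fderiv ℝ f)) :=
    (hf.fderiv_right (m := 1) (by norm_num)).continuous_fderiv (by norm_num)
  have hsphere : ∀ᶠ y in 𝓝 x, ∀ v ∈ Metric.sphere (0 : EuclideanSpace ℝ (Fin n)) 1,
      0 < fderiv ℝ (fderiv ℝ f) y v v := by
    refine (isCompact_sphere _ _).eventually_forall_of_forall_eventually fun v hv => ?_
    have hΦ : Continuous fun p : EuclideanSpace ℝ (Fin n) × EuclideanSpace ℝ (Fin n) =>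
        fderiv ℝ (fderiv ℝ f) p.1 p.2 p.2 := by fun_prop
    exact hΦ.continuousAt.eventually_const_lt
      ((mem_hessPos_iff hf).1 hx v (ne_zero_of_mem_unit_sphere ⟨v, hv⟩))
  filter_upwards [hsphere] with y hy
  refine (mem_hessPos_iff hf).2 fun v hv => ?_
  have hnorm : 0 < ‖v‖ := norm_pos_iff.2 hv
  have h := hy (‖v‖⁻¹ • v) (by simp [norm_smul, hnorm.ne'])
  simp only [map_smul, _root_.smul_apply, smul_eq_mul] at h
  exact pos_of_mul_pos_right (pos_of_mul_pos_right h (by positivity)) (by positivity)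

/-! ### Convexity of truncations -/

/-- The truncation at height `q` is convex when the Hessian is positive definite on `{q ≤ f}`. -/
theorem convexOn_truncation (hf : ContDiff ℝ 2 f) {q : ℝ} (hq : ∀ x, q ≤ f x → x ∈ hessPos f) :
    ConvexOn ℝ univ (truncation q f) := by
  refine ⟨convex_univ, fun x _ y _ a b ha hb hab => ?_⟩
  obtain rfl | hxy := eq_or_ne x y
  · rw [← add_smul, ← add_smul, hab, one_smul, one_smul]
  have hline : ∀ t : ℝ, HasDerivAt (fun u : ℝ => x + u • (y - x)) (y - x) t := fun t => by
    simpa using ((hasDerivAt_id t).smul_const (y - x)).const_add x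
  have h₁ : ∀ t : ℝ, HasDerivAt (fun u : ℝ => f (x + u • (y - x)))
      (fderiv ℝ f (x + t • (y - x)) (y - x)) t := fun t =>
    ((hf.differentiable (by norm_num)) _).hasFDerivAt.comp_hasDerivAt t (hline t)
  have h₂ : ∀ t : ℝ, HasDerivAt (fun u : ℝ => fderiv ℝ f (x + u • (y - x)) (y - x))
      (fderiv ℝ (fderiv ℝ f) (x + t • (y - x)) (y - x) (y - x)) t := fun t => by
    simpa using ((differentiable_fderiv hf _).hasFDerivAt.comp_hasDerivAt t (hline t)).clm_apply
      (hasDerivAt_const t (y - x))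
  have key := max_le_chord_of_deriv_deriv_pos (φ := fun u => f (x + u • (y - x)))
    (fun t => (h₁ t).differentiableAt) q
    (fun t ht => by
      rw [funext fun u => (h₁ u).deriv, (h₂ t).deriv]
      exact (mem_hessPos_iff hf).1 (hq _ ht) _ (sub_ne_zero.2 hxy.symm))
    (t := b) ⟨hb, by linarith⟩
  obtain rfl : a = 1 - b := by linarith
  have hpt : (1 - b) • x + b • y = x + b • (y - x) := by module
  simpa [truncation, hpt] using key

/-- A convexity level is a quasiconvexity level. -/
theorem convexityLevels_subset : convexityLevels f ⊆ quasiconvexityLevels f :=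
  fun _ hq => ⟨hq.1, fun r hr => (hq.2 r hr).quasiconvexOn⟩

theorem mem_convexityLevels (hf : ContDiff ℝ 2 f) {q : ℝ} (hq : ∀ x, q ≤ f x → x ∈ hessPos f)
    {z : EuclideanSpace ℝ (Fin n)} (hz : f z ≤ q) : q ∈ convexityLevels f :=
  ⟨(iInf_le _ z).trans (EReal.coe_le_coe_iff.2 hz),
    fun _ hr => convexOn_truncation hf fun x hx => hq x (hr.trans hx)⟩

theorem isGreatest_hMax (hf : ContDiff ℝ 2 f) (hb : Bornology.IsBounded (hessPos f)ᶜ)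
    (hne : (hessPos f)ᶜ.Nonempty) : IsGreatest (f '' (hessPos f)ᶜ) (hMax f) := by
  have hcomp : IsCompact (hessPos f)ᶜ :=
    Metric.isCompact_of_isClosed_isBounded (isOpen_hessPos hf).isClosed_compl hb
  exact (hcomp.image hf.continuous).isGreatest_sSup (hne.image f)

theorem mem_convexityLevels_of_hMax_lt (hf : ContDiff ℝ 2 f)
    (hb : Bornology.IsBounded (hessPos f)ᶜ) (hne : (hessPos f)ᶜ.Nonempty) {q : ℝ}
    (hq : hMax f < q) : q ∈ convexityLevels f := by
  obtain ⟨⟨z, -, hz⟩, hub⟩ := isGreatest_hMax hf hb hne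
  refine mem_convexityLevels hf (fun x hx => ?_) (z := z) (by rw [hz]; exact hq.le)
  by_contra hx'
  exact (hq.trans_le hx).not_ge (hub ⟨x, hx', rfl⟩)

theorem sInf_coe_image_le {S : Set ℝ} {a : ℝ} (h : Ioi a ⊆ S) :
    sInf ((fun q : ℝ => (q : EReal)) '' S) ≤ (a : EReal) := by
  refine EReal.le_of_forall_lt_iff_le.1 fun q hq => ?_
  exact sInf_le ⟨q, h (EReal.coe_lt_coe_iff.1 hq), rfl⟩

theorem convex_sublevel {q : ℝ} (hq : q ∈ convexityLevels f) : Convex ℝ {x | f x ≤ q} := by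
  simpa [truncation] using (hq.2 q le_rfl).convex_le q

end TruncConvex

theorem corollary3p4 (n : ℕ) (hn : n = 2 ∨ n = 3) (f : EuclideanSpace ℝ (Fin n) → ℝ)
    (hcoercive : Filter.Tendsto f (Bornology.cobounded (EuclideanSpace ℝ (Fin n))) Filter.atTop)
    (hsmooth : ContDiff ℝ 2 f)
    (hHess : Bornology.IsBounded (TruncConvex.hessPos f)ᶜ)
    (hCrit : Bornology.IsBounded (TruncConvex.criticalSet f)) :
    TruncConvex.TruncatedConvex f ∧ TruncConvex.TruncatedQuasiconvex f ∧
      ((TruncConvex.hessPos f)ᶜ.Nonempty →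
        IsGreatest (f '' (TruncConvex.hessPos f)ᶜ) (TruncConvex.hMax f) ∧
        TruncConvex.scl f ≤ (TruncConvex.hMax f : EReal) ∧
        (∀ q : ℝ, TruncConvex.hMax f < q → Convex ℝ {x | f x ≤ q}) ∧
        TruncConvex.sql f ≤ (TruncConvex.hMax f : EReal)) := by
  open TruncConvex in
  have hconv : TruncatedConvex f := by
    rcases (hessPos f)ᶜ.eq_empty_or_nonempty with he | hne
    · exact ⟨f 0, mem_convexityLevels hsmooth
        (fun x _ => (compl_empty_iff.1 he).symm ▸ mem_univ x) le_rfl⟩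
    · exact ⟨hMax f + 1, mem_convexityLevels_of_hMax_lt hsmooth hHess hne (lt_add_one _)⟩
  refine ⟨hconv, hconv.mono TruncConvex.convexityLevels_subset, fun hne => ?_⟩
  have hlevel : ∀ q, TruncConvex.hMax f < q → q ∈ TruncConvex.convexityLevels f := fun _ =>
    TruncConvex.mem_convexityLevels_of_hMax_lt hsmooth hHess hne
  exact ⟨TruncConvex.isGreatest_hMax hsmooth hHess hne,
    TruncConvex.sInf_coe_image_le hlevel,
    fun q hq => TruncConvex.convex_sublevel (hlevel q hq),
    TruncConvex.sInf_coe_image_le fun q hq => TruncConvex.convexityLevels_subset (hlevel q hq)⟩
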